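/- Let $\mu$ be the Lebesgue (fair coin product) measure on $2^\omega$ and let $\mathscr N$ be the ideal of $\mu$-null subsets of $2^\omega$. For $a\subseteq 2^{<\omega}$ put $\pi(a)=\{x\in 2^\omega : x\restriction n\in a \text{ for infinitely many } n\in\omega\}$, and let $\mathrm{tr}(\mathscr N)=\{a\subseteq 2^{<\omega} : \pi(a)\in\mathscr N\}$ and $\mathrm{tr}(\mathscr N)^+=\mathcal P(2^{<\omega})\setminus\mathrm{tr}(\mathscr N)$. A perfect tree is a nonempty set $p\subseteq 2^{<\omega}$ closed under initial segments such that every $s\in p$ has two incompatible extensions in $p$. Sacks forcing $\mathbf S$ is the set of all perfect trees ordered by inclusion. A family $\mathcal R$ of infinite subsets of $\omega$ is a Halpern--Läuchli family if for every $c\colon 2^{<\omega}\to 2$ there are $p\in\mathbf S$ and $A\in\mathcal R$ such that $c$ is constant on $\{s\in p : |s|\in A\}$. An ideal $\mathcal I$ on a countably infinite set $X$ is HL if $\mathcal I^+$ is a Halpern--Läuchli family when $X$ is identified with $\omega$ through any bijection. Theorem. (i) $\mathrm{tr}(\mathscr N)$ is a proper ideal on $2^{<\omega}$ containing all finite sets,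 and it is HL. (ii) Let $\dot a$ be an $\mathbf S$-name and let $p\in\mathbf S$ force that $\dot a\subseteq 2^{<\omega}$. Then $p$ forces that there is a set $b$ in the ground model family $\mathrm{tr}(\mathscr N)^+$ which reaps $\dot a$, that is, such that $b\subseteq\dot a$ or $b\cap\dot a=\emptyset$. -/

import Mathlib

/-! ### The binary tree, the Cantor space and Sacks forcing

The tree `2^{<ω}` is `List Bool`, ordered by the prefix relation `<+:`; the level of a node is its
length.  The Cantor space `2^ω` is `ℕ → Bool`. -/

/-- The restriction `x ↾ n` of a point of the Cantor space. -/
def restrictTo (x : ℕ → Bool) (n : ℕ) : List Bool :=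
  List.ofFn fun i : Fin n => x i

/-- Two nodes of `2^{<ω}` are compatible if one of them extends the other. -/
def NodesCompatible (s t : List Bool) : Prop := s <+: t ∨ t <+: s

/-- A (nonempty) perfect subtree of `2^{<ω}`. -/
structure IsPerfectTree (p : Set (List Bool)) : Prop where
  nonempty : p.Nonempty
  initial : ∀ s t, s <+: t → t ∈ p → s ∈ p
  splits : ∀ s ∈ p, ∃ s₀ ∈ p, ∃ s₁ ∈ p,
    NodesCompatible s s₀ ∧ NodesCompatible s s₁ ∧ ¬ NodesCompatible s₀ s₁

/-- Sacks forcing: the perfect subtrees of `2^{<ω}`, ordered by inclusion. -/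
abbrev Sacks : Type := {p : Set (List Bool) // IsPerfectTree p}

/-! ### Ideals and the Halpern–Läuchli property -/

/-- `I` is a proper ideal on the set `X` that contains all finite sets. -/
structure IsProperIdealOn {X : Type} (I : Set (Set X)) : Prop where
  isIdeal : Order.IsIdeal I
  finite_mem : ∀ a : Set X, a.Finite → a ∈ I
  univ_notMem : Set.univ ∉ I

/-- The coideal `I⁺` of all sets that are not in `I`. -/
def coideal {X : Type} (I : Set (Set X)) : Set (Set X) := {a | a ∉ I}

/-- `R` is a Halpern–Läuchli family: it consists of infinite subsets of `ω`, and for every colouring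
`c : 2^{<ω} → 2` there are a perfect tree `p` and `A ∈ R` such that `c` is constant on the set
`p ↾ A` of all nodes of `p` whose level is in `A`. -/
def IsHalpernLauchliFamily (R : Set (Set ℕ)) : Prop :=
  (∀ A ∈ R, A.Infinite) ∧
    ∀ c : List Bool → Bool, ∃ p : Sacks, ∃ A ∈ R, ∃ i : Bool,
      ∀ s ∈ p.1, s.length ∈ A → c s = i

/-- An ideal `I` on a countably infinite set `X` is HL if `I⁺` is a Halpern–Läuchli family, where `X`
is identified with `ω` through any bijection. -/
def IsHLIdeal {X : Type} [Countable X] [Infinite X] (I : Set (Set X)) : Prop :=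
  IsProperIdealOn I ∧
    ∀ e : X ≃ ℕ, IsHalpernLauchliFamily ((fun a => e '' a) '' coideal I)

/-! ### The trace ideal of the null ideal -/

/-- The product (Lebesgue) measure on the Cantor space `2^ω`. -/
noncomputable def cantorMeasure : MeasureTheory.Measure (ℕ → Bool) :=
  MeasureTheory.Measure.infinitePi fun _ : ℕ => (PMF.uniformOfFintype Bool).toMeasure

/-- The ideal `𝒩` of null subsets of `2^ω`. -/
def nullIdeal : Set (Set (ℕ → Bool)) := {B | cantorMeasure B = 0}

/-- `π(a)`: the points `x` with `x ↾ n ∈ a` for infinitely many `n`. -/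
def limitPoints (a : Set (List Bool)) : Set (ℕ → Bool) :=
  {x | {n : ℕ | restrictTo x n ∈ a}.Infinite}

/-- The trace ideal `tr(I)` of an ideal `I` on `2^ω`. -/
def traceIdeal (I : Set (Set (ℕ → Bool))) : Set (Set (List Bool)) := {a | limitPoints a ∈ I}

/-! ### Names and the forcing relation

The ground model is the universe of pre-sets `PSet.{0}`; smaller conditions are stronger. -/

/-- A `P`-name is a set of pairs `(σ, c)` of a `P`-name `σ` and a condition `c`. -/
inductive PName (P : Type) : Type 1
  | mk (ι : Type) (elt : ι → PName P) (cond : ι → P) : PName P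

namespace PName

variable {P : Type}

/-- The index type of the pairs that make up a name. -/
def Idx : PName P → Type
  | mk ι _ _ => ι

/-- The name in the `i`-th pair. -/
def elt : (τ : PName P) → τ.Idx → PName P
  | mk _ e _ => e

/-- The condition in the `i`-th pair. -/
def cond : (τ : PName P) → τ.Idx → P
  | mk _ _ c => c

/-- The canonical name `x̌ = {(y̌, c) : y ∈ x, c ∈ P}` of a ground model set `x`. -/
def check : PSet.{0} → PName P
  | PSet.mk α A => mk (α × P) (fun i => check (A i.1)) (fun i => i.2)

variable [Preorder P]

/-- `p ⊩ σ = τ`. -/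
def ForcesEq : PName P → PName P → P → Prop
  | mk ι e c, mk κ f d => fun p =>
    (∀ i : ι, ∀ q ≤ p, q ≤ c i → ∃ r ≤ q, ∃ j : κ, r ≤ d j ∧ ForcesEq (e i) (f j) r) ∧
      (∀ j : κ, ∀ q ≤ p, q ≤ d j → ∃ r ≤ q, ∃ i : ι, r ≤ c i ∧ ForcesEq (e i) (f j) r)

/-- `p ⊩ σ ∈ τ`: the conditions `r` such that `r ≤ c` and `r ⊩ σ = π` for some `(π, c)` in `τ` are
dense below `p`. -/
def ForcesMem (σ τ : PName P) (p : P) : Prop :=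
  ∀ q ≤ p, ∃ r ≤ q, ∃ i : τ.Idx, r ≤ τ.cond i ∧ ForcesEq σ (τ.elt i) r

/-- `p ⊩ ¬ φ`, where `φ q` stands for `q ⊩ φ`. -/
def ForcesNot (φ : P → Prop) (p : P) : Prop := ∀ q ≤ p, ¬ φ q

/-- `p ⊩ φ ∨ ψ`. -/
def ForcesOr (φ ψ : P → Prop) (p : P) : Prop := ∀ q ≤ p, ∃ r ≤ q, φ r ∨ ψ r

/-- `p ⊩ ∀ x ∈ τ, φ(x)`. -/
def ForcesBall (τ : PName P) (φ : PName P → P → Prop) (p : P) : Prop :=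
  ∀ i : τ.Idx, ∀ q ≤ p, q ≤ τ.cond i → φ (τ.elt i) q

/-- `p ⊩ ∃ x ∈ τ, φ(x)`. -/
def ForcesBex (τ : PName P) (φ : PName P → P → Prop) (p : P) : Prop :=
  ∀ q ≤ p, ∃ r ≤ q, ∃ i : τ.Idx, r ≤ τ.cond i ∧ φ (τ.elt i) r

/-- `p ⊩ σ ⊆ τ`, that is, `p ⊩ ∀ x ∈ σ, x ∈ τ`. -/
def ForcesSubset (σ τ : PName P) : P → Prop :=
  ForcesBall σ fun π => ForcesMem π τ

/-- `p ⊩ σ ∩ τ = ∅`, that is, `p ⊩ ∀ x ∈ σ, ¬ x ∈ τ`. -/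
def ForcesDisjoint (σ τ : PName P) : P → Prop :=
  ForcesBall σ fun π => ForcesNot (ForcesMem π τ)

/-- `p ⊩ σ reaps τ`, that is, `p ⊩ σ ⊆ τ ∨ σ ∩ τ = ∅`. -/
def ForcesReaps (σ τ : PName P) : P → Prop :=
  ForcesOr (ForcesSubset σ τ) (ForcesDisjoint σ τ)

/-- `p ⊩ ∃ x ∈ ρ, x reaps τ`. -/
def ForcesReapedByMember (ρ τ : PName P) : P → Prop :=
  ForcesBex ρ fun π => ForcesReaps π τ

end PName

/-! ### The binary tree as a ground model set -/

/-- The ordered pair `(x, y) = {{x}, {x, y}}`. -/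
def pairPSet (x y : PSet.{0}) : PSet.{0} := {{x}, {x, y}}

/-- A node of `2^{<ω}` as a set: the finite sequence `s : n → 2` as a set of ordered pairs. -/
def nodePSet (s : List Bool) : PSet.{0} :=
  PSet.mk (Fin s.length) fun i =>
    pairPSet (PSet.ofNat (i : ℕ)) (PSet.ofNat (s.get i).toNat)

/-- A subset of `2^{<ω}` as a set. -/
def nodeSetPSet (a : Set (List Bool)) : PSet.{0} :=
  PSet.mk a fun s => nodePSet s

/-- A family of subsets of `2^{<ω}` as a set. -/
def familyPSet (F : Set (Set (List Bool))) : PSet.{0} :=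
  PSet.mk F fun a => nodeSetPSet a

open Set Filter MeasureTheory Topology
open scoped ENNReal symmDiff

/-! ### Restrictions and limit points -/

/-! The Halpern–Läuchli property comes from a measure-valued ultrafilter. Given `c`, each branch `x`
induces the colouring `t ↦ c (x ↾ e t)` of `2^{<ω}`. A maximal consistent family of pairs `(a, B)`
acts as a random-forcing name for an ultrafilter all of whose members `a` satisfy `y ∈ π(a)`, where
`y` is the random real. It decides every colouring almost everywhere (`Maximal.exists_decision`), so
each `x` gets a colour whose truth value `B x` has measure at least 1/2. Some colour `i` serves
uncountably many `x`, and since the measure algebra is separable, these contain a set `D` that is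
dense in itself for branches and values jointly (`exists_homogeneous_branches`).

A fusion over finite subsets of `D` then splits branches while the common truth value keeps measure
above 1/4. Each stage provides a finite set of nodes `t` good for all current branches and covering
measure more than 1/4. The union of these sets is not in `tr(𝒩)`, and the branches generate the
perfect tree (`exists_homogeneous_perfectTree`).

For names, continuous reading (`exists_isSacksScheme`) turns the membership questions about `τ` into
a colouring of `2^{<ω}`, with one question per level. Fusing along a homogeneous perfect tree gives
one answer for all nodes of a positive set. -/

@[simp] lemma length_restrictTo (x : ℕ → Bool) (n : ℕ) : (restrictTo x n).length = n := by
  simp [restrictTo]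

lemma take_restrictTo (x : ℕ → Bool) {m n : ℕ} (h : m ≤ n) :
    (restrictTo x n).take m = restrictTo x m := by
  apply List.ext_getElem
  · simpa using h
  · intro i h1 h2
    simp [restrictTo]

lemma restrictTo_prefix (x : ℕ → Bool) {m n : ℕ} (h : m ≤ n) :
    restrictTo x m <+: restrictTo x n := by
  rw [← take_restrictTo x h]
  exact List.take_prefix _ _

lemma eq_restrictTo_of_prefix {s : List Bool} {x : ℕ → Bool} {n : ℕ}
    (h : s <+: restrictTo x n) : s = restrictTo x s.length := by
  have hl : s.length ≤ n := by simpa using h.length_le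
  rw [← take_restrictTo x hl]
  exact List.prefix_iff_eq_take.1 h

lemma restrictTo_eq_iff {x y : ℕ → Bool} {n : ℕ} :
    restrictTo x n = restrictTo y n ↔ ∀ i < n, x i = y i := by
  simp only [restrictTo, List.ofFn_inj, funext_iff]
  exact ⟨fun h i hi => h ⟨i, hi⟩, fun h i => h i i.2⟩

lemma restrictTo_eq_of_le {x y : ℕ → Bool} {m n : ℕ} (hmn : m ≤ n)
    (h : restrictTo x n = restrictTo y n) : restrictTo x m = restrictTo y m :=
  restrictTo_eq_iff.2 fun i hi => restrictTo_eq_iff.1 h i (hi.trans_le hmn)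

lemma measurableSet_restrictTo_mem (a : Set (List Bool)) (n : ℕ) :
    MeasurableSet {x : ℕ → Bool | restrictTo x n ∈ a} := by
  have hg : Measurable fun (x : ℕ → Bool) (i : Fin n) => x i :=
    measurable_pi_lambda _ fun i => measurable_pi_apply _
  exact hg (t := {f | List.ofFn f ∈ a}) (Set.Finite.measurableSet (Set.toFinite _))

lemma limitPoints_eq_iInter (a : Set (List Bool)) :
    limitPoints a = ⋂ k : ℕ, {x | ∃ n, k ≤ n ∧ restrictTo x n ∈ a} := by
  ext x
  simp only [limitPoints, mem_ofPred_eq, mem_iInter, Set.infinite_iff_exists_gt]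
  constructor
  · intro h k
    obtain ⟨n, hn, hk⟩ := h k
    exact ⟨n, hk.le, hn⟩
  · intro h k
    obtain ⟨n, hk, hn⟩ := h (k + 1)
    exact ⟨n, hn, hk⟩

lemma measurableSet_exists_restrictTo_mem (a : Set (List Bool)) (k : ℕ) :
    MeasurableSet {x : ℕ → Bool | ∃ n, k ≤ n ∧ restrictTo x n ∈ a} := by
  have : {x : ℕ → Bool | ∃ n, k ≤ n ∧ restrictTo x n ∈ a} =
      ⋃ n : ℕ, ⋃ _ : k ≤ n, {x | restrictTo x n ∈ a} := by
    ext x; simp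
  rw [this]
  exact .iUnion fun n => .iUnion fun _ => measurableSet_restrictTo_mem a n

lemma measurableSet_limitPoints (a : Set (List Bool)) : MeasurableSet (limitPoints a) := by
  rw [limitPoints_eq_iInter]
  exact .iInter fun k => measurableSet_exists_restrictTo_mem a k

lemma limitPoints_mono {a b : Set (List Bool)} (h : a ⊆ b) : limitPoints a ⊆ limitPoints b :=
  fun _ hx => Set.Infinite.mono (fun _ hn => h hn) hx

lemma limitPoints_union (a b : Set (List Bool)) :
    limitPoints (a ∪ b) ⊆ limitPoints a ∪ limitPoints b := fun x hx => by
  have h : {n | restrictTo x n ∈ a ∪ b} = {n | restrictTo x n ∈ a} ∪ {n | restrictTo x n ∈ b} :=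
    rfl
  rw [limitPoints, mem_ofPred_eq, h, Set.infinite_union] at hx
  exact hx

lemma limitPoints_univ : limitPoints Set.univ = Set.univ := by
  ext x
  simpa [limitPoints] using Set.infinite_univ

lemma limitPoints_eq_empty {a : Set (List Bool)} (ha : a.Finite) : limitPoints a = ∅ := by
  ext x
  simp only [mem_empty_iff_false, iff_false, limitPoints, mem_ofPred_eq, Set.not_infinite]
  refine ha.preimage (f := restrictTo x) fun m _ n _ h => ?_
  simpa using congrArg List.length h

instance : IsProbabilityMeasure cantorMeasure := by
  unfold cantorMeasure
  infer_instance

lemma isProperIdealOn_traceIdeal_nullIdeal : IsProperIdealOn (traceIdeal nullIdeal) where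
  isIdeal :=
    { IsLowerSet := fun a b hba ha => measure_mono_null (limitPoints_mono hba) ha
      Nonempty := ⟨∅, by simp [traceIdeal, nullIdeal, limitPoints_eq_empty]⟩
      Directed := fun a ha b hb => ⟨a ∪ b,
        measure_mono_null (limitPoints_union a b) (measure_union_null ha hb),
        subset_union_left, subset_union_right⟩ }
  finite_mem a ha := by simp [traceIdeal, nullIdeal, limitPoints_eq_empty ha]
  univ_notMem := by simp [traceIdeal, nullIdeal, limitPoints_univ]

/-! ### Boolean-valued ultrafilters -/

section Ultrafilter

variable {X Y : Type*} [MeasurableSpace Y]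

/-- The family `F` of pairs `(a, B)`, read as "`a` belongs to the ultrafilter with value at least
`B`", is consistent with `φ`. -/
def IsConsistentFamily (μ : Measure Y) (φ : Set X → Set Y) (F : Set (Set X × Set Y)) : Prop :=
  (∀ q ∈ F, MeasurableSet q.2) ∧
    ∀ G ⊆ F, G.Finite → ∀ᵐ y ∂μ, (∀ q ∈ G, y ∈ q.2) → y ∈ φ (⋂ q ∈ G, q.1)

variable {μ : Measure Y} {φ : Set X → Set Y} {F : Set (Set X × Set Y)}

lemma exists_maximal_isConsistentFamily (μ : Measure Y) (huniv : φ univ = univ) :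
    ∃ F, Maximal (IsConsistentFamily (X := X) μ φ) F := by
  have hF : Order.IsOfFiniteCharacter {F | IsConsistentFamily (X := X) μ φ F} := by
    intro F
    constructor
    · exact fun h G hG _ => ⟨fun q hq => h.1 q (hG hq), fun H hH => h.2 H (hH.trans hG)⟩
    · intro h
      refine ⟨fun q hq => ?_, fun G hG hfin => (h G hG hfin).2 G subset_rfl hfin⟩
      exact (h {q} (by simpa using hq) (finite_singleton q)).1 q rfl
  obtain ⟨F, -, hF⟩ := hF.exists_maximal (x := ∅) ⟨by simp, fun G hG _ => by
    simp [subset_empty_iff.1 hG, huniv]⟩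
  exact ⟨F, hF⟩

lemma Maximal.mem_of_forall_ae (hF : Maximal (IsConsistentFamily μ φ) F) {a : Set X} {B : Set Y}
    (hB : MeasurableSet B)
    (h : ∀ G ⊆ F, G.Finite → ∀ᵐ y ∂μ, y ∈ B → (∀ q ∈ G, y ∈ q.2) → y ∈ φ (a ∩ ⋂ q ∈ G, q.1)) :
    (a, B) ∈ F := by
  refine hF.mem_of_prop_insert ⟨?_, fun G hG hfin => ?_⟩
  · rintro q (rfl | hq)
    exacts [hB, hF.prop.1 q hq]
  · by_cases hmem : (a, B) ∈ G
    · have hG' : G \ {(a, B)} ⊆ F := fun q hq => (hG hq.1).resolve_left hq.2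
      filter_upwards [h _ hG' hfin.sdiff] with y hy hall
      have := hy (hall _ hmem) fun q hq => hall q hq.1
      have heq : (a ∩ ⋂ q ∈ G \ {(a, B)}, q.1) = ⋂ q ∈ G, q.1 := by
        conv_rhs => rw [← insert_sdiff_self_of_mem hmem, biInter_insert]
      rwa [heq] at this
    · exact hF.prop.2 G (fun q hq => (hG hq).resolve_left fun h => hmem (h ▸ hq)) hfin

/-- Countably many null exceptional sets have null union, so truth values are closed under countable
joins. -/
lemma Maximal.iUnion_mem (hF : Maximal (IsConsistentFamily μ φ) F) {a : Set X} {B : ℕ → Set Y}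
    (hB : ∀ n, (a, B n) ∈ F) : (a, ⋃ n, B n) ∈ F := by
  refine hF.mem_of_forall_ae (.iUnion fun n => hF.prop.1 _ (hB n)) fun G hG hfin => ?_
  have := fun n => hF.prop.2 (insert (a, B n) G) (insert_subset (hB n) hG) (hfin.insert _)
  filter_upwards [ae_all_iff.2 this] with y hy hyB hall
  obtain ⟨n, hn⟩ := mem_iUnion.1 hyB
  simpa only [biInter_insert] using hy n (by simpa [hn] using hall)

lemma Maximal.union_mem (hF : Maximal (IsConsistentFamily μ φ) F) {a : Set X} {B C : Set Y}
    (hB : (a, B) ∈ F) (hC : (a, C) ∈ F) : (a, B ∪ C) ∈ F := by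
  have := hF.iUnion_mem (B := fun n => if n = 0 then B else C) (a := a) fun n => by
    by_cases h : n = 0 <;> simp [h, hB, hC]
  convert this using 2
  ext y
  constructor
  · rintro (h | h)
    exacts [mem_iUnion.2 ⟨0, by simpa⟩, mem_iUnion.2 ⟨1, by simpa⟩]
  · intro h
    obtain ⟨n, hn⟩ := mem_iUnion.1 h
    by_cases h : n = 0 <;> simp_all

/-- Exhaustion: the union of a sequence of values whose measures tend to the supremum is itself a
value, so no other value can exceed it by positive measure. -/
lemma Maximal.exists_largest [IsFiniteMeasure μ] (hF : Maximal (IsConsistentFamily μ φ) F)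
    (a : Set X) : ∃ B, (a, B) ∈ F ∧ ∀ C, (a, C) ∈ F → μ (C \ B) = 0 := by
  have hempty : (a, ∅) ∈ F := hF.mem_of_forall_ae .empty fun G _ _ => by simp
  set S : Set ℝ≥0∞ := μ '' {B | (a, B) ∈ F}
  obtain ⟨u, -, hu, hmem⟩ := exists_seq_tendsto_sSup (S := S) ⟨_, ∅, hempty, rfl⟩ (OrderTop.bddAbove S)
  choose B hB hBu using hmem
  have hUn := hF.iUnion_mem hB
  refine ⟨_, hUn, fun C hC => ?_⟩
  have h1 : sSup S ≤ μ (⋃ n, B n) :=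
    le_of_tendsto' hu fun n => hBu n ▸ measure_mono (subset_iUnion B n)
  have h2 : μ ((⋃ n, B n) ∪ C) ≤ μ (⋃ n, B n) :=
    (le_sSup (mem_image_of_mem μ (hF.union_mem hUn hC))).trans h1
  have hBm : MeasurableSet (⋃ n, B n) := hF.prop.1 _ hUn
  have hCm : MeasurableSet C := hF.prop.1 _ hC
  rw [← union_sdiff_self, measure_union disjoint_sdiff_right (hCm.diff hBm)] at h2
  have := ENNReal.cancel_of_ne (measure_ne_top μ (⋃ n, B n))
  simpa using this.add_le_iff_nonpos_right.1 h2

/-- A maximal consistent family decides every set almost everywhere. -/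
lemma Maximal.exists_decision [IsFiniteMeasure μ] (hF : Maximal (IsConsistentFamily μ φ) F)
    (hmono : ∀ a b, a ⊆ b → φ a ⊆ φ b) (hunion : ∀ a b, φ (a ∪ b) ⊆ φ a ∪ φ b)
    (hmeas : ∀ a, MeasurableSet (φ a)) (a : Set X) :
    ∃ B C, (a, B) ∈ F ∧ (aᶜ, C) ∈ F ∧ μ (B ∪ C)ᶜ = 0 := by
  obtain ⟨B, hB, hBmax⟩ := hF.exists_largest a
  obtain ⟨C, hC, hCmax⟩ := hF.exists_largest aᶜ
  refine ⟨B, C, hB, hC, ?_⟩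
  have hD : MeasurableSet (B ∪ C)ᶜ := ((hF.prop.1 _ hB).union (hF.prop.1 _ hC)).compl
  have hmem : (a, (B ∪ C)ᶜ) ∈ F := by
    refine hF.mem_of_forall_ae hD fun G hG hfin => ?_
    -- `E` is where `a`, with value `(B ∪ C)ᶜ`, would contradict `G`. On `E` the complement of `a`
    -- must be chosen, so `E` is a value of `aᶜ`. It misses `C`, hence is null.
    set E : Set Y := ((B ∪ C)ᶜ ∩ ⋂ q ∈ G, q.2) \ φ (a ∩ ⋂ q ∈ G, q.1)
    have hE : MeasurableSet E := (hD.inter (hfin.measurableSet_biInter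
      fun q hq => hF.prop.1 q (hG hq))).diff (hmeas _)
    have hEF : (aᶜ, E) ∈ F := by
      refine hF.mem_of_forall_ae hE fun H hH hHfin => ?_
      filter_upwards [hF.prop.2 _ (union_subset hG hH) (hfin.union hHfin)] with y hy hyE hall
      have hyG : ∀ q ∈ G, y ∈ q.2 := by simpa using hyE.1.2
      have h1 := hy fun q hq => hq.elim (hyG q) (hall q)
      rw [biInter_union] at h1
      refine (hunion (a ∩ ⋂ q ∈ G, q.1) (aᶜ ∩ ⋂ q ∈ H, q.1) (hmono _ _ ?_ h1)).resolve_left hyE.2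
      rintro t ⟨hG', hH'⟩
      by_cases ht : t ∈ a
      exacts [Or.inl ⟨ht, hG'⟩, Or.inr ⟨ht, hH'⟩]
    refine measure_mono_null (t := E \ C) (fun y hy => ?_) (hCmax E hEF)
    simp only [mem_compl_iff, mem_ofPred_eq, Classical.not_imp] at hy
    refine ⟨⟨⟨hy.1, by simpa using hy.2.1⟩, hy.2.2⟩, fun h => hy.1 (Or.inr h)⟩
  refine measure_mono_null (fun y hy => ?_) (hBmax _ hmem)
  exact ⟨hy, fun h => hy (Or.inl h)⟩

end Ultrafilter

/-! ### Dense-in-itself sets of branches -/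

/-- Cantor–Bendixson for the topology on `ι` induced by `g`. The nearby point differs as an index;
`g` need not be injective. -/
lemma exists_selfAccumulating {ι α : Type*} [Uncountable ι] [TopologicalSpace α]
    [SecondCountableTopology α] (g : ι → α) :
    ∃ D : Set ι, D.Nonempty ∧ ∀ x ∈ D, ∀ U ∈ 𝓝 (g x), ∃ y ∈ D, y ≠ x ∧ g y ∈ U := by
  let _ : TopologicalSpace ι := .induced g inferInstance
  have _ : SecondCountableTopology ι := TopologicalSpace.secondCountableTopology_induced ι α g
  obtain ⟨D, hD, hne, -⟩ := exists_perfect_nonempty_of_isClosed_of_not_countable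
    (isClosed_univ (X := ι)) Set.not_countable_univ
  refine ⟨D, hne, fun x hx U hU => ?_⟩
  obtain ⟨y, hy, hyx⟩ := preperfect_iff_nhds.1 hD.acc x hx (g ⁻¹' U)
    (continuous_induced_dom.continuousAt hU)
  exact ⟨y, hy.2, hyx, hy.1⟩

lemma restrictTo_eq_mem_nhds (x : ℕ → Bool) (N : ℕ) :
    {y | restrictTo y N = restrictTo x N} ∈ 𝓝 x := by
  simp only [restrictTo_eq_iff]
  have : {y : ℕ → Bool | ∀ i < N, y i = x i} = ⋂ i ∈ Finset.range N, {y | y i = x i} := by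
    ext; simp
  rw [this, Filter.biInter_finset_mem]
  exact fun i _ => (continuous_apply i).continuousAt (isOpen_discrete {x i} |>.mem_nhds rfl)

/-- Indicators embed the sets `B x` into the separable space `L¹`, where distance is the measure of
the symmetric difference. -/
lemma exists_selfAccumulating_branches {B : (ℕ → Bool) → Set (ℕ → Bool)}
    (hB : ∀ x, MeasurableSet (B x)) {S : Set (ℕ → Bool)} (hS : ¬ S.Countable) :
    ∃ D ⊆ S, D.Nonempty ∧ ∀ x ∈ D, ∀ N : ℕ, ∀ ε : ℝ≥0∞, ε ≠ 0 →
      ∃ y ∈ D, y ≠ x ∧ restrictTo y N = restrictTo x N ∧ cantorMeasure (B x \ B y) < ε := by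
  have : Uncountable S := not_countable_iff.1 hS
  let f : (ℕ → Bool) → Lp ℝ 1 cantorMeasure := fun x =>
    indicatorConstLp 1 (hB x) (measure_ne_top _ _) 1
  have hf : ∀ x y, edist (f x) (f y) = cantorMeasure (B x ∆ B y) := fun x y => by
    rw [edist_indicatorConstLp_eq_enorm, indicatorConstLp, Lp.enorm_toLp,
      eLpNorm_indicator_const ((hB x).symmDiff (hB y)) one_ne_zero ENNReal.one_ne_top]
    simp
  have : Fact ((1 : ℝ≥0∞) ≠ ∞) := ⟨ENNReal.one_ne_top⟩
  obtain ⟨D, hne, hD⟩ := exists_selfAccumulating fun x : S => ((x : ℕ → Bool), f x)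
  refine ⟨(↑) '' D, Subtype.coe_image_subset _ _, hne.image _, ?_⟩
  rintro _ ⟨x, hx, rfl⟩ N ε hε
  obtain ⟨y, hy, hyx, h1, h2⟩ := hD x hx _ (prod_mem_nhds (restrictTo_eq_mem_nhds x N)
    (Metric.eball_mem_nhds (f x) (pos_iff_ne_zero.2 hε)))
  refine ⟨y, mem_image_of_mem _ hy, fun h => hyx (Subtype.ext h), h1, ?_⟩
  rw [Metric.mem_eball, edist_comm, hf] at h2
  exact (measure_mono subset_union_left).trans_lt h2

lemma exists_homogeneous_branches (c : (ℕ → Bool) → List Bool → Bool) :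
    ∃ (i : Bool) (D : Set (ℕ → Bool)) (B : (ℕ → Bool) → Set (ℕ → Bool)), D.Nonempty ∧
      (∀ x ∈ D, 2⁻¹ ≤ cantorMeasure (B x)) ∧
      (∀ x ∈ D, ∀ N : ℕ, ∀ ε : ℝ≥0∞, ε ≠ 0 →
        ∃ y ∈ D, y ≠ x ∧ restrictTo y N = restrictTo x N ∧ cantorMeasure (B x \ B y) < ε) ∧
      ∀ G ⊆ D, G.Finite →
        cantorMeasure (⋂ x ∈ G, B x) ≤ cantorMeasure (limitPoints (⋂ x ∈ G, {t | c x t = i})) := by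
  obtain ⟨F, hF⟩ := exists_maximal_isConsistentFamily cantorMeasure limitPoints_univ
  have key : ∀ x, ∃ i : Bool, ∃ B, ({t | c x t = i}, B) ∈ F ∧ 2⁻¹ ≤ cantorMeasure B := by
    intro x
    obtain ⟨B, C, hB, hC, hnull⟩ := hF.exists_decision (fun _ _ => limitPoints_mono)
      limitPoints_union measurableSet_limitPoints {t | c x t = true}
    have hC' : ({t | c x t = false}, C) ∈ F := by
      convert hC using 2
      ext t; simp
    by_contra! hcon
    have h1 : cantorMeasure (B ∪ C) = 1 := by
      rw [← prob_compl_eq_zero_iff ((hF.prop.1 _ hB).union (hF.prop.1 _ hC)), hnull]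
    refine absurd h1 (ne_of_lt ?_)
    calc cantorMeasure (B ∪ C) ≤ cantorMeasure B + cantorMeasure C := measure_union_le _ _
      _ < 2⁻¹ + 2⁻¹ := ENNReal.add_lt_add (hcon _ _ hB) (hcon _ _ hC')
      _ = 1 := ENNReal.inv_two_add_inv_two
  choose i B hBF hBμ using key
  have hB : ∀ x, MeasurableSet (B x) := fun x => hF.prop.1 _ (hBF x)
  obtain ⟨j, hj⟩ : ∃ j, ¬ {x | i x = j}.Countable := by
    by_contra! h
    have huniv : (univ : Set (ℕ → Bool)).Countable :=
      (countable_iUnion h).mono fun x _ => mem_iUnion.2 ⟨i x, rfl⟩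
    have := countable_univ_iff.1 huniv
    obtain ⟨f, hf⟩ := exists_surjective_nat (ℕ → Bool)
    obtain ⟨n, hn⟩ := hf fun n => !f n n
    simpa using congrFun hn n
  obtain ⟨D, hDS, hne, hD⟩ := exists_selfAccumulating_branches hB hj
  refine ⟨j, D, B, hne, fun x _ => hBμ x, hD, fun G hG hfin => measure_mono_ae ?_⟩
  have := hF.prop.2 ((fun x => ({t | c x t = j}, B x)) '' G) (by
    rintro _ ⟨x, hx, rfl⟩
    have : i x = j := hDS (hG hx)
    exact this ▸ hBF x) (hfin.image _)
  filter_upwards [this] with y hy hyB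
  rw [biInter_image] at hy
  refine hy ?_
  rintro _ ⟨x, hx, rfl⟩
  exact mem_iInter₂.1 hyB x hx

/-! ### Fusion -/

lemma measure_limitPoints_ge {a : Set (List Bool)} {r : ℝ≥0∞}
    (h : ∀ k : ℕ, r ≤ cantorMeasure {x | ∃ n, k ≤ n ∧ restrictTo x n ∈ a}) :
    r ≤ cantorMeasure (limitPoints a) := by
  rw [limitPoints_eq_iInter, Antitone.measure_iInter]
  · exact le_iInf h
  · exact fun k l hkl x ⟨n, hn, hx⟩ => ⟨n, hkl.trans hn, hx⟩
  · exact fun k => (measurableSet_exists_restrictTo_mem a k).nullMeasurableSet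
  · exact ⟨0, measure_ne_top _ _⟩

/-- Continuity from below: bounding the lengths of the nodes makes the set finite and loses
arbitrarily little measure. -/
lemma exists_finite_cover {a : Set (List Bool)} {r : ℝ≥0∞} (h : r < cantorMeasure (limitPoints a))
    (k : ℕ) :
    ∃ b ⊆ a, b.Finite ∧ r < cantorMeasure {x | ∃ n, k ≤ n ∧ restrictTo x n ∈ b} := by
  have hsub : limitPoints a ⊆
      ⋃ M : ℕ, {x | ∃ n, k ≤ n ∧ restrictTo x n ∈ a ∩ {s | s.length ≤ M}} := by
    intro x hx
    rw [limitPoints_eq_iInter] at hx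
    obtain ⟨n, hn, hxn⟩ := mem_iInter.1 hx k
    exact mem_iUnion.2 ⟨n, n, hn, hxn, by simp⟩
  have hlt := h.trans_le (measure_mono hsub)
  have hmono : Monotone fun M : ℕ =>
      {x | ∃ n, k ≤ n ∧ restrictTo x n ∈ a ∩ {s | s.length ≤ M}} :=
    fun M M' hM x ⟨n, hn, hx⟩ => ⟨n, hn, hx.1, le_trans hx.2 hM⟩
  rw [hmono.measure_iUnion, lt_iSup_iff] at hlt
  obtain ⟨M, hM⟩ := hlt
  exact ⟨_, inter_subset_left, (List.finite_length_le Bool M).subset inter_subset_right, hM⟩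

section Fusion

variable {D : Set (ℕ → Bool)} {B : (ℕ → Bool) → Set (ℕ → Bool)}

lemma exists_finite_splitting {r : ℝ≥0∞} (hD : ∀ x ∈ D, ∀ N : ℕ, ∀ ε : ℝ≥0∞, ε ≠ 0 →
      ∃ y ∈ D, y ≠ x ∧ restrictTo y N = restrictTo x N ∧ cantorMeasure (B x \ B y) < ε)
    {F : Set (ℕ → Bool)} (hFD : F ⊆ D) (hF : F.Finite) (hμ : r < cantorMeasure (⋂ x ∈ F, B x))
    (N : ℕ) :
    ∃ F', F ⊆ F' ∧ F' ⊆ D ∧ F'.Finite ∧ r < cantorMeasure (⋂ x ∈ F', B x) ∧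
      (∀ x ∈ F', ∃ y ∈ F, restrictTo x N = restrictTo y N) ∧
      ∀ x ∈ F, ∃ y ∈ F', y ≠ x ∧ restrictTo y N = restrictTo x N := by
  suffices ∀ G ⊆ F, G.Finite →
    ∃ F', F ⊆ F' ∧ F' ⊆ D ∧ F'.Finite ∧ r < cantorMeasure (⋂ x ∈ F', B x) ∧
      (∀ x ∈ F', ∃ y ∈ F, restrictTo x N = restrictTo y N) ∧
      ∀ x ∈ G, ∃ y ∈ F', y ≠ x ∧ restrictTo y N = restrictTo x N from this F subset_rfl hF
  intro G hGF hG
  induction G, hG using Set.Finite.induction_on with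
  | empty => exact ⟨F, subset_rfl, hFD, hF, hμ, fun x hx => ⟨x, hx, rfl⟩, by simp⟩
  | @insert x G _ _ ih =>
    obtain ⟨F', hFF', hF'D, hF', hμ', hagree, hsplit⟩ := ih ((subset_insert _ _).trans hGF)
    have hxF : x ∈ F := hGF (mem_insert _ _)
    -- The tolerance is the current slack above `r`, so adding `y` keeps the strict inequality.
    obtain ⟨y, hyD, hyx, hyN, hyμ⟩ := hD x (hFD hxF) N _ (tsub_pos_iff_lt.2 hμ').ne'
    refine ⟨insert y F', hFF'.trans (subset_insert _ _), insert_subset hyD hF'D, hF'.insert y,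
      ?_, ?_, ?_⟩
    · have h1 : (⋂ z ∈ F', B z) ⊆ (⋂ z ∈ insert y F', B z) ∪ (B x \ B y) := by
        intro w hw
        by_cases hwy : w ∈ B y
        · exact Or.inl (by simpa only [biInter_insert] using ⟨hwy, hw⟩)
        · exact Or.inr ⟨mem_iInter₂.1 hw x (hFF' hxF), hwy⟩
      have h2 := (measure_mono h1).trans (measure_union_le (μ := cantorMeasure) _ _)
      by_contra! hle
      refine absurd h2 (not_le.2 ?_)
      calc _ < r + (cantorMeasure (⋂ z ∈ F', B z) - r) :=
            ENNReal.add_lt_add_of_le_of_lt (hle.trans_lt (hμ'.trans_le le_top)).ne hle hyμ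
        _ = _ := add_tsub_cancel_of_le hμ'.le
    · rintro z (rfl | hz)
      exacts [⟨x, hxF, hyN⟩, hagree z hz]
    · rintro z (rfl | hz)
      · exact ⟨y, mem_insert _ _, hyx, hyN⟩
      · obtain ⟨w, hw, h⟩ := hsplit z hz
        exact ⟨w, mem_insert_of_mem _ hw, h⟩

lemma eventually_restrictTo_ne {x y : ℕ → Bool} (h : y ≠ x) :
    ∀ᶠ N in atTop, restrictTo y N ≠ restrictTo x N := by
  obtain ⟨n, hn⟩ := Function.ne_iff.1 h
  filter_upwards [eventually_gt_atTop n] with N hN heq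
  exact hn (restrictTo_eq_iff.1 heq n hN)

variable {e : List Bool → ℕ} {c : List Bool → Bool} {i : Bool}

/-- The order of choices matters: the branches are split first, then `b` is taken good for all of
them, and only then is `N'` put beyond the splittings and all levels `e t` with `t ∈ b`. -/
lemma exists_fusion_step {r : ℝ≥0∞} (hD : ∀ x ∈ D, ∀ N : ℕ, ∀ ε : ℝ≥0∞, ε ≠ 0 →
      ∃ y ∈ D, y ≠ x ∧ restrictTo y N = restrictTo x N ∧ cantorMeasure (B x \ B y) < ε)
    (hB : ∀ G ⊆ D, G.Finite → cantorMeasure (⋂ x ∈ G, B x) ≤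
      cantorMeasure (limitPoints (⋂ x ∈ G, {t | c (restrictTo x (e t)) = i})))
    {F : Set (ℕ → Bool)} (hFD : F ⊆ D) (hF : F.Finite) (hμ : r < cantorMeasure (⋂ x ∈ F, B x))
    (N k : ℕ) :
    ∃ (F' : Set (ℕ → Bool)) (N' : ℕ) (b : Set (List Bool)),
      (F' ⊆ D ∧ F'.Finite ∧ r < cantorMeasure (⋂ x ∈ F', B x)) ∧
      F ⊆ F' ∧ N ≤ N' ∧ (∀ x ∈ F', ∃ y ∈ F, restrictTo x N = restrictTo y N) ∧
      (∀ x ∈ F, ∃ y ∈ F', restrictTo y N = restrictTo x N ∧ restrictTo y N' ≠ restrictTo x N') ∧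
      (∀ t ∈ b, e t ≤ N' ∧ ∀ x ∈ F', c (restrictTo x (e t)) = i) ∧
      r < cantorMeasure {x | ∃ n, k ≤ n ∧ restrictTo x n ∈ b} := by
  obtain ⟨F', hFF', hF'D, hF', hμ', hagree, hsplit⟩ := exists_finite_splitting hD hFD hF hμ N
  obtain ⟨b, hba, hb, hbμ⟩ := exists_finite_cover (hμ'.trans_le (hB F' hF'D hF')) k
  choose! g hgF hgne hgN using hsplit
  have hN' : ∀ᶠ N' in atTop, N ≤ N' ∧ (∀ x ∈ F, restrictTo (g x) N' ≠ restrictTo x N') ∧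
      ∀ t ∈ b, e t ≤ N' :=
    (eventually_ge_atTop N).and ((hF.eventually_all.2
      fun x hx => eventually_restrictTo_ne (hgne x hx)).and
      (hb.eventually_all.2 fun t _ => eventually_ge_atTop (e t)))
  obtain ⟨N', h1, h2, h3⟩ := hN'.exists
  exact ⟨F', N', b, ⟨hF'D, hF', hμ'⟩, hFF', h1, hagree,
    fun x hx => ⟨g x, hgF x hx, hgN x hx, h2 x hx⟩,
    fun t ht => ⟨h3 t ht, fun x hx => mem_iInter₂.1 (hba ht) x hx⟩, hbμ⟩

end Fusion

/-- The Halpern–Läuchli property of `tr(𝒩)`. -/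
theorem exists_homogeneous_perfectTree (e : List Bool → ℕ) (c : List Bool → Bool) :
    ∃ (p : Sacks) (b : Set (List Bool)) (i : Bool), b ∈ coideal (traceIdeal nullIdeal) ∧
      ∀ t ∈ b, ∀ s ∈ p.1, s.length = e t → c s = i := by
  obtain ⟨i, D, B, ⟨x₀, hx₀⟩, hhalf, hD, hB⟩ :=
    exists_homogeneous_branches fun x t => c (restrictTo x (e t))
  let St := {q : Set (ℕ → Bool) × ℕ // q.1 ⊆ D ∧ q.1.Finite ∧
    4⁻¹ < cantorMeasure (⋂ x ∈ q.1, B x)}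
  have step : ∀ (k : ℕ) (q : St), ∃ (q' : St) (b : Set (List Bool)),
      q.1.1 ⊆ q'.1.1 ∧ q.1.2 ≤ q'.1.2 ∧
      (∀ x ∈ q'.1.1, ∃ y ∈ q.1.1, restrictTo x q.1.2 = restrictTo y q.1.2) ∧
      (∀ x ∈ q.1.1, ∃ y ∈ q'.1.1, restrictTo y q.1.2 = restrictTo x q.1.2 ∧
        restrictTo y q'.1.2 ≠ restrictTo x q'.1.2) ∧
      (∀ t ∈ b, e t ≤ q'.1.2 ∧ ∀ x ∈ q'.1.1, c (restrictTo x (e t)) = i) ∧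
      4⁻¹ < cantorMeasure {x | ∃ n, k ≤ n ∧ restrictTo x n ∈ b} := by
    rintro k ⟨⟨F, N⟩, hFD, hF, hμ⟩
    obtain ⟨F', N', b, hF', h⟩ := exists_fusion_step hD hB hFD hF hμ N k
    exact ⟨⟨⟨F', N'⟩, hF'⟩, b, h⟩
  choose next b hnext using step
  let q₀ : St := ⟨⟨{x₀}, 0⟩, by simpa using hx₀, finite_singleton _, by
    simp only [mem_singleton_iff, iInter_iInter_eq_left]
    refine lt_of_lt_of_le ?_ (hhalf x₀ hx₀)
    exact ENNReal.inv_lt_inv.2 (by norm_num)⟩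
  let q : ℕ → St := fun n => Nat.rec q₀ next n
  let F : ℕ → Set (ℕ → Bool) := fun k => (q k).1.1
  let N : ℕ → ℕ := fun k => (q k).1.2
  let b' : ℕ → Set (List Bool) := fun k => b k (q k)
  have hmono : Monotone F := monotone_nat_of_le_succ fun k => (hnext k (q k)).1
  have hNmono : Monotone N := monotone_nat_of_le_succ fun k => (hnext k (q k)).2.1
  -- Later stages add no new nodes up to level `N k`.
  have hagree : ∀ k j, k ≤ j → ∀ x ∈ F j, ∃ y ∈ F k, restrictTo x (N k) = restrictTo y (N k) := by
    intro k j hkj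
    induction j, hkj using Nat.le_induction with
    | base => exact fun x hx => ⟨x, hx, rfl⟩
    | succ j hkj ih =>
      intro x hx
      obtain ⟨y, hy, hxy⟩ := (hnext j (q j)).2.2.1 x hx
      obtain ⟨z, hz, hyz⟩ := ih y hy
      exact ⟨z, hz, (restrictTo_eq_of_le (hNmono hkj) hxy).trans hyz⟩
  have hsplit : ∀ k, ∀ x ∈ F k, ∃ y ∈ F (k + 1), restrictTo y (N k) = restrictTo x (N k) ∧
      restrictTo y (N (k + 1)) ≠ restrictTo x (N (k + 1)) := fun k => (hnext k (q k)).2.2.2.1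
  have hb : ∀ k, ∀ t ∈ b' k, e t ≤ N (k + 1) ∧ ∀ x ∈ F (k + 1), c (restrictTo x (e t)) = i :=
    fun k => (hnext k (q k)).2.2.2.2.1
  have hbμ : ∀ k, 4⁻¹ < cantorMeasure {x | ∃ n, k ≤ n ∧ restrictTo x n ∈ b' k} :=
    fun k => (hnext k (q k)).2.2.2.2.2
  have hperfect : IsPerfectTree {s | ∃ k, ∃ x ∈ F k, s <+: restrictTo x (N k)} := by
    refine ⟨⟨[], 0, x₀, rfl, List.nil_prefix⟩, ?_, ?_⟩
    · rintro s t hst ⟨k, x, hx, h⟩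
      exact ⟨k, x, hx, hst.trans h⟩
    · rintro s ⟨k, x, hx, h⟩
      obtain ⟨y, hy, hyx, hne⟩ := hsplit k x hx
      have hN := hNmono (Nat.le_succ k)
      refine ⟨restrictTo x (N (k + 1)), ⟨k + 1, x, hmono (Nat.le_succ k) hx, List.prefix_rfl⟩,
        restrictTo y (N (k + 1)), ⟨k + 1, y, hy, List.prefix_rfl⟩,
        Or.inl (h.trans (restrictTo_prefix x hN)),
        Or.inl ((hyx ▸ h).trans (restrictTo_prefix y hN)), ?_⟩
      rintro (h | h)
      · exact hne (h.eq_of_length (by simp)).symm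
      · exact hne (h.eq_of_length (by simp))
  refine ⟨⟨_, hperfect⟩, ⋃ k, b' k, i, ?_, ?_⟩
  · have := measure_limitPoints_ge (a := ⋃ k, b' k) (r := 4⁻¹) fun k =>
      (hbμ k).le.trans (measure_mono fun x ⟨n, hn, hx⟩ => ⟨n, hn, mem_iUnion.2 ⟨k, hx⟩⟩)
    intro h
    rw [show cantorMeasure (limitPoints (⋃ k, b' k)) = 0 from h] at this
    simp at this
  · rintro t ht s ⟨j, x, hx, hs⟩ hlen
    obtain ⟨k, hk⟩ := mem_iUnion.1 ht
    obtain ⟨hN, hc⟩ := hb k t hk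
    rw [eq_restrictTo_of_prefix hs, hlen]
    -- Since `e t ≤ N (k + 1)`, a branch from a later stage can be replaced by one in `F (k + 1)`;
    -- earlier branches already lie there.
    rcases le_total (k + 1) j with hkj | hkj
    · obtain ⟨y, hy, hxy⟩ := hagree _ _ hkj x hx
      rw [restrictTo_eq_of_le hN hxy]
      exact hc y hy
    · exact hc x (hmono hkj hx)

theorem isHLIdeal_traceIdeal_nullIdeal : IsHLIdeal (traceIdeal nullIdeal) := by
  refine ⟨isProperIdealOn_traceIdeal_nullIdeal, fun e => ⟨?_, fun c => ?_⟩⟩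
  · rintro _ ⟨a, ha, rfl⟩
    refine Set.Infinite.image e.injective.injOn fun hfin => ha ?_
    exact isProperIdealOn_traceIdeal_nullIdeal.finite_mem a hfin
  · obtain ⟨p, b, i, hb, h⟩ := exists_homogeneous_perfectTree e c
    refine ⟨p, _, mem_image_of_mem _ hb, i, ?_⟩
    rintro s hs ⟨t, ht, hts⟩
    exact h t ht s hs hts.symm

/-! ### Perfect trees -/

lemma NodesCompatible.symm {s t : List Bool} (h : NodesCompatible s t) : NodesCompatible t s :=
  Or.symm h

lemma NodesCompatible.mono {s t s' t' : List Bool} (h : NodesCompatible s' t') (hs : s <+: s')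
    (ht : t <+: t') : NodesCompatible s t := by
  rcases h with h | h
  · exact List.prefix_or_prefix_of_prefix (hs.trans h) ht
  · exact List.prefix_or_prefix_of_prefix hs (ht.trans h)

lemma eq_of_nodesCompatible {s t : List Bool} (h : NodesCompatible s t)
    (hl : s.length = t.length) : s = t :=
  h.elim (fun h => h.eq_of_length hl) fun h => (h.eq_of_length hl.symm).symm

lemma exists_split_of_not_nodesCompatible : ∀ {s t : List Bool}, ¬ NodesCompatible s t →
    ∃ l b, l ++ [b] <+: s ∧ l ++ [!b] <+: t
  | [], t, h => (h (Or.inl List.nil_prefix)).elim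
  | a :: s, [], h => (h (Or.inr List.nil_prefix)).elim
  | a :: s, a' :: t, h => by
    by_cases haa : a' = a
    · subst haa
      obtain ⟨l, b, h1, h2⟩ := exists_split_of_not_nodesCompatible (s := s) (t := t)
        (fun h' => h (by simpa [NodesCompatible] using h'))
      exact ⟨a' :: l, b, by simpa using h1, by simpa using h2⟩
    · exact ⟨[], a, by simp, by simpa using Bool.eq_not_of_ne (Ne.symm haa)⟩

namespace IsPerfectTree

variable {p : Set (List Bool)}

lemma exists_split (hp : IsPerfectTree p) {s : List Bool} (hs : s ∈ p) :
    ∃ t : Bool → List Bool, (∀ b, t b ∈ p) ∧ (∀ b, s <+: t b) ∧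
      ¬ NodesCompatible (t false) (t true) := by
  obtain ⟨s₀, h₀, s₁, h₁, hc₀, hc₁, hne⟩ := hp.splits s hs
  have hs₀ : s <+: s₀ := hc₀.resolve_right fun h => hne (hc₁.mono h List.prefix_rfl)
  have hs₁ : s <+: s₁ := hc₁.resolve_right fun h => hne (hc₀.mono h List.prefix_rfl).symm
  exact ⟨fun b => if b then s₁ else s₀, by simp [h₀, h₁], by simp [hs₀, hs₁], by simpa⟩

lemma exists_long_extension (hp : IsPerfectTree p) {s : List Bool} (hs : s ∈ p) (n : ℕ) :
    ∃ t ∈ p, s <+: t ∧ n ≤ t.length := by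
  induction n with
  | zero => exact ⟨s, hs, List.prefix_rfl, Nat.zero_le _⟩
  | succ n ih =>
    obtain ⟨t, ht, hst, hn⟩ := ih
    obtain ⟨u, hu, htu, hne⟩ := hp.exists_split ht
    refine ⟨u false, hu _, hst.trans (htu _), ?_⟩
    refine Nat.succ_le_of_lt (hn.trans_lt ((htu false).length_le.lt_of_ne fun hl => hne ?_))
    exact Or.inl ((htu false).eq_of_length hl ▸ htu true)

lemma restrict (hp : IsPerfectTree p) {s : List Bool} (hs : s ∈ p) :
    IsPerfectTree {v ∈ p | NodesCompatible v s} := by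
  refine ⟨⟨s, hs, Or.inl List.prefix_rfl⟩, fun v w hvw hw => ⟨hp.initial v w hvw hw.1,
    hw.2.mono hvw List.prefix_rfl⟩, ?_⟩
  rintro v ⟨hv, hvs⟩
  obtain ⟨w, hw, hvw, hsw⟩ : ∃ w ∈ p, v <+: w ∧ s <+: w := by
    rcases hvs with h | h
    exacts [⟨s, hs, h, List.prefix_rfl⟩, ⟨v, hv, List.prefix_rfl, h⟩]
  obtain ⟨t, ht, hwt, hne⟩ := hp.exists_split hw
  exact ⟨t false, ⟨ht _, Or.inr (hsw.trans (hwt _))⟩, t true, ⟨ht _, Or.inr (hsw.trans (hwt _))⟩,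
    Or.inl (hvw.trans (hwt _)), Or.inl (hvw.trans (hwt _)), hne⟩

end IsPerfectTree

/-! ### Fusion of Sacks conditions -/

/-- A scheme of Sacks conditions `q σ` with incompatible nodes `u σ`, indexed by `2^{<ω}`. -/
structure IsSacksScheme (q : List Bool → Sacks) (u : List Bool → List Bool) : Prop where
  mem : ∀ σ, u σ ∈ (q σ).1
  le : ∀ σ b, q (σ ++ [b]) ≤ q σ
  prefix_append : ∀ σ b, u σ <+: u (σ ++ [b])
  incompatible : ∀ σ, ¬ NodesCompatible (u (σ ++ [false])) (u (σ ++ [true]))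

namespace IsSacksScheme

variable {q : List Bool → Sacks} {u : List Bool → List Bool}

lemma mono (h : IsSacksScheme q u) {σ ρ : List Bool} (hσρ : σ <+: ρ) :
    q ρ ≤ q σ ∧ u σ <+: u ρ := by
  obtain ⟨l, rfl⟩ := hσρ
  induction l using List.reverseRecOn with
  | nil => simp
  | append_singleton l b ih =>
    rw [← List.append_assoc]
    exact ⟨(h.le _ b).trans ih.1, ih.2.trans (h.prefix_append _ b)⟩

lemma not_nodesCompatible (h : IsSacksScheme q u) {σ ρ : List Bool}
    (hσρ : ¬ NodesCompatible σ ρ) : ¬ NodesCompatible (u σ) (u ρ) := by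
  obtain ⟨l, b, h1, h2⟩ := exists_split_of_not_nodesCompatible hσρ
  intro hc
  have := hc.mono (h.mono h1).2 (h.mono h2).2
  cases b
  exacts [h.incompatible l this, h.incompatible l this.symm]

lemma isPerfectTree_fusion (h : IsSacksScheme q u) {p : Set (List Bool)} (hp : IsPerfectTree p) :
    IsPerfectTree {s | ∃ σ ∈ p, s <+: u σ} := by
  refine ⟨?_, fun s t hst ⟨σ, hσ, ht⟩ => ⟨σ, hσ, hst.trans ht⟩, ?_⟩
  · obtain ⟨σ, hσ⟩ := hp.nonempty
    exact ⟨u σ, σ, hσ, List.prefix_rfl⟩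
  · rintro s ⟨σ, hσ, hs⟩
    obtain ⟨t, ht, hσt, hne⟩ := hp.exists_split hσ
    exact ⟨u (t false), ⟨_, ht _, List.prefix_rfl⟩, u (t true), ⟨_, ht _, List.prefix_rfl⟩,
      Or.inl (hs.trans (h.mono (hσt _)).2), Or.inl (hs.trans (h.mono (hσt _)).2),
      h.not_nodesCompatible hne⟩

/-- A node `s` of `r` that is at least as long as every `u σ` with `|σ| = n` determines which `u σ`
lies below it. Restricting `r` to `s` puts it below that `q σ`. -/
lemma fusion_predense (h : IsSacksScheme q u) {p : Set (List Bool)} (hp : IsPerfectTree p)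
    (n : ℕ) {r : Sacks} (hr : r ≤ ⟨_, h.isPerfectTree_fusion hp⟩) :
    ∃ r' ≤ r, ∃ σ ∈ p, σ.length = n ∧ r' ≤ q σ := by
  have hlong : ∀ s ∈ r.1, ∃ ρ ∈ p, n ≤ ρ.length ∧ s <+: u ρ := by
    intro s hs
    obtain ⟨σ, hσ, hsσ⟩ := hr hs
    obtain ⟨ρ, hρ, hσρ, hn⟩ := hp.exists_long_extension hσ n
    exact ⟨ρ, hρ, hn, hsσ.trans (h.mono hσρ).2⟩
  obtain ⟨M, hM⟩ := ((List.finite_length_eq Bool n).image fun σ => (u σ).length).bddAbove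
  obtain ⟨s₀, hs₀⟩ := r.2.nonempty
  obtain ⟨s, hs, -, hsM⟩ := r.2.exists_long_extension hs₀ M
  obtain ⟨ρ, hρ, hn, hsρ⟩ := hlong s hs
  have hlen : (ρ.take n).length = n := by simpa using hn
  have htake : ρ.take n <+: ρ := List.take_prefix _ _
  have hus : u (ρ.take n) <+: s := List.prefix_of_prefix_length_le (h.mono htake).2 hsρ
    ((hM (mem_image_of_mem _ hlen)).trans hsM)
  refine ⟨⟨_, r.2.restrict hs⟩, fun v hv => hv.1, ρ.take n, hp.initial _ _ htake hρ, hlen, ?_⟩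
  rintro v ⟨hv, hvs | hsv⟩
  · exact (h.mono htake).1 ((q ρ).2.initial _ _ (hvs.trans hsρ) (h.mem ρ))
  · obtain ⟨ρ', hρ', hn', hvρ'⟩ := hlong v hv
    have htake' : ρ'.take n <+: ρ' := List.take_prefix _ _
    have hlen' : (ρ'.take n).length = n := by simpa using hn'
    have heq : ρ'.take n = ρ.take n := by
      by_contra hne
      refine h.not_nodesCompatible (fun hc => hne (eq_of_nodesCompatible hc (hlen'.trans hlen.symm)))
        (List.prefix_or_prefix_of_prefix (h.mono htake').2 (hus.trans (hsv.trans hvρ')))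
    exact (h.mono (heq ▸ htake')).1 ((q ρ').2.initial _ _ hvρ' (h.mem ρ'))

end IsSacksScheme

/-- Continuous reading: below every Sacks condition there is a scheme whose conditions on level `n`
meet the `n`-th of countably many dense sets. -/
theorem exists_isSacksScheme {φ : ℕ → Set Sacks} (hφ : ∀ n p, ∃ q ≤ p, q ∈ φ n) (p : Sacks) :
    ∃ q u, IsSacksScheme q u ∧ q [] ≤ p ∧ ∀ σ, q σ ∈ φ σ.length := by
  have step : ∀ (n : ℕ) (x : {x : Sacks × List Bool // x.2 ∈ x.1.1}),
      ∃ y : Bool → {x : Sacks × List Bool // x.2 ∈ x.1.1},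
        (∀ b, (y b).1.1 ≤ x.1.1) ∧ (∀ b, x.1.2 <+: (y b).1.2) ∧ (∀ b, (y b).1.1 ∈ φ n) ∧
        ¬ NodesCompatible (y false).1.2 (y true).1.2 := by
    rintro n ⟨⟨q, u⟩, hu⟩
    obtain ⟨t, ht, hut, hne⟩ := q.2.exists_split hu
    -- Restricting to `t b` before meeting the dense set forces long nodes of `r b` to extend `t b`,
    -- which keeps the two sides incompatible.
    choose r hr hrφ using fun b => hφ n ⟨_, q.2.restrict (ht b)⟩
    have hlong : ∀ b, ∃ v ∈ (r b).1, t b <+: v := fun b => by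
      obtain ⟨s, hs⟩ := (r b).2.nonempty
      obtain ⟨v, hv, -, hlen⟩ := (r b).2.exists_long_extension hs (t b).length
      refine ⟨v, hv, (hr b hv).2.elim (fun h => ?_) id⟩
      exact (h.eq_of_length (h.length_le.antisymm hlen)) ▸ List.prefix_rfl
    choose v hv htv using hlong
    exact ⟨fun b => ⟨⟨r b, v b⟩, hv b⟩, fun b w hw => (hr b hw).1, fun b => (hut b).trans (htv b),
      hrφ, fun h => hne (h.mono (htv _) (htv _))⟩
  choose next hle hprefix hnextφ hinc using step
  obtain ⟨q₀, hq₀, hq₀φ⟩ := hφ 0 p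
  obtain ⟨u₀, hu₀⟩ := q₀.2.nonempty
  -- `List.rec` adds bits at the head while the scheme grows at the end, hence the reversals below.
  -- A child of `σ` meets the dense set of its own length `σ.length + 1`.
  let st : List Bool → {x : Sacks × List Bool // x.2 ∈ x.1.1} :=
    fun σ => List.rec ⟨⟨q₀, u₀⟩, hu₀⟩ (fun b σ x => next (σ.length + 1) x b) σ
  have hst : ∀ b σ, st (b :: σ) = next (σ.length + 1) (st σ) b := fun _ _ => rfl
  refine ⟨fun σ => (st σ.reverse).1.1, fun σ => (st σ.reverse).1.2,
    ⟨fun σ => (st σ.reverse).2, fun σ b => ?_, fun σ b => ?_, fun σ => ?_⟩, hq₀, fun σ => ?_⟩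
  · simpa [hst] using hle _ _ b
  · simpa [hst] using hprefix _ _ b
  · simpa [hst] using hinc _ _
  · induction σ using List.reverseRecOn with
    | nil => exact hq₀φ
    | append_singleton σ b _ => simpa [hst] using hnextφ (σ.length + 1) _ b

/-! ### Names -/

namespace PName

lemma ForcesMem.mono {P : Type} [Preorder P] {σ τ : PName P} {p q : P} (h : ForcesMem σ τ p)
    (hq : q ≤ p) : ForcesMem σ τ q :=
  fun r hr => h r (hr.trans hq)

lemma forcesMem_of_predense {P : Type} [Preorder P] {σ τ : PName P} {p : P}
    (h : ∀ q ≤ p, ∃ r ≤ q, ForcesMem σ τ r) : ForcesMem σ τ p := fun q hq => by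
  obtain ⟨r, hr, hf⟩ := h q hq
  obtain ⟨s, hs, i, hi⟩ := hf r le_rfl
  exact ⟨s, hs.trans hr, i, hi⟩

/-- The condition `q` decides the truth value of `σ ∈ τ` to be `i`. -/
def DecidesMem {P : Type} [Preorder P] (σ τ : PName P) : Bool → P → Prop
  | true => ForcesMem σ τ
  | false => ForcesNot (ForcesMem σ τ)

lemma exists_decidesMem {P : Type} [Preorder P] (σ τ : PName P) (p : P) :
    ∃ q ≤ p, ∃ i, DecidesMem σ τ i q := by
  by_cases h : ∃ q ≤ p, ForcesMem σ τ q
  · obtain ⟨q, hq, h⟩ := h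
    exact ⟨q, hq, true, h⟩
  · exact ⟨p, le_rfl, false, fun q hq hf => h ⟨q, hq, hf⟩⟩

lemma decidesMem_of_predense {P : Type} [Preorder P] {σ τ : PName P} {p : P} {i : Bool}
    (h : ∀ q ≤ p, ∃ r ≤ q, DecidesMem σ τ i r) : DecidesMem σ τ i p := by
  cases i
  · intro q hq hf
    obtain ⟨r, hr, hd⟩ := h q hq
    exact hd r le_rfl (hf.mono hr)
  · exact forcesMem_of_predense h

lemma DecidesMem.mono {P : Type} [Preorder P] {σ τ : PName P} {i : Bool} {p q : P}
    (h : DecidesMem σ τ i p) (hq : q ≤ p) : DecidesMem σ τ i q := by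
  cases i
  · exact fun r hr => h r (hr.trans hq)
  · exact ForcesMem.mono h hq

lemma forcesReaps_check_nodeSetPSet {P : Type} [Preorder P] {τ : PName P} {b : Set (List Bool)}
    {i : Bool} {p : P} (h : ∀ t ∈ b, DecidesMem (check (nodePSet t)) τ i p) :
    ForcesReaps (check (nodeSetPSet b)) τ p := by
  intro q hq
  refine ⟨q, le_rfl, ?_⟩
  cases i
  · exact Or.inr fun j r hr _ => (h _ j.1.2).mono (hr.trans hq)
  · exact Or.inl fun j r hr _ => ForcesMem.mono (h _ j.1.2) (hr.trans hq)

end PName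

/-- Every Sacks name for a subset of `2^{<ω}` is reaped by a ground model set outside `tr(𝒩)`. -/
theorem forcesReapedByMember_coideal_traceIdeal (τ : PName Sacks) (p : Sacks) :
    PName.ForcesReapedByMember
      (PName.check (familyPSet (coideal (traceIdeal nullIdeal)))) τ p := by
  intro p' _
  obtain ⟨e⟩ : Nonempty (List Bool ≃ ℕ) := nonempty_equiv_of_countable
  -- Level `n` decides the node `e.symm n`, so level `e s` settles whether `s` is in `τ`.
  obtain ⟨q, u, hqu, hqp, hdec⟩ := exists_isSacksScheme
    (φ := fun n => {q | ∃ i, PName.DecidesMem (PName.check (nodePSet (e.symm n))) τ i q})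
    (fun n q => PName.exists_decidesMem _ τ q) p'
  choose c hc using hdec
  obtain ⟨t, b, i, hb, ht⟩ := exists_homogeneous_perfectTree e c
  let r : Sacks := ⟨_, hqu.isPerfectTree_fusion t.2⟩
  have hr : r ≤ p' := by
    rintro s ⟨σ, -, hs⟩
    exact hqp ((hqu.mono List.nil_prefix).1 ((q σ).2.initial _ _ hs (hqu.mem σ)))
  refine ⟨r, hr, ⟨⟨b, hb⟩, r⟩, le_rfl, PName.forcesReaps_check_nodeSetPSet (i := i) fun s hs => ?_⟩
  -- Densely below `r`, conditions lie below some `q σ` with `σ` in the homogeneous tree on level `e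
  -- s`, where the answer is `i`.
  refine PName.decidesMem_of_predense fun r₁ hr₁ => ?_
  obtain ⟨r₂, hr₂, σ, hσ, hlen, hσq⟩ := hqu.fusion_predense t.2 (e s) hr₁
  refine ⟨r₂, hr₂, ?_⟩
  have := (hc σ).mono hσq
  rwa [ht s hs σ hσ hlen, hlen, e.symm_apply_apply] at this

theorem mainTheorem8 :
    IsHLIdeal (traceIdeal nullIdeal) ∧
      ∀ (τ : PName Sacks) (p : Sacks),
        PName.ForcesSubset τ (PName.check (nodeSetPSet Set.univ)) p →
          PName.ForcesReapedByMember
            (PName.check (familyPSet (coideal (traceIdeal nullIdeal)))) τ p :=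
  ⟨isHLIdeal_traceIdeal_nullIdeal, fun τ p _ => forcesReapedByMember_coideal_traceIdeal τ p⟩
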